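/- Let $M$ be a locally compact Hausdorff space and let $\varphi:\mathbb{R}_{\ge 0}\times M\to M$ be a (global) semiflow, i.e. a continuous map with $\varphi(0,x)=x$ and $\varphi(s,\varphi(t,x))=\varphi(s+t,x)$ for all $x\in M$, $s,t\ge 0$; write $\varphi^t=\varphi(t,\cdot)$. Suppose that $\varphi$ has no start points: every $x\in M$ is of the form $x=\varphi^t(y)$ for some $t>0$ and $y\in M$. Let $A\subseteq M$ be a compact set such that (i) $A$ is invariant, $\varphi(\mathbb{R},A)=A$, where for $t\ge 0$ one puts $\varphi(t,A)=\varphi^t(A)$ and $\varphi(-t,A)=(\varphi^t)^{-1}(A)$; equivalently, for all $t\ge0$ and $x\in M$, $\varphi^t(x)\in A$ if and only if $x\in A$; (ii) $A$ is Lyapunov stable: every open $U\supseteq A$ contains an open $V\supseteq A$ with $\varphi^t(V)\subseteq U$ for all $t\ge 0$; (iii) $A$ is locally attractive: there is an open $W\supseteq A$ such that for every $p\in W$ and every open $V\supseteq A$ there is $T\ge 0$ with $\varphi^t(p)\in V$ for all $t\ge T$. Let $\mathcal{D}(A)$ be the domain of attraction of $A$, i.e. the set of all $p\in M$ such that for every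 open $U\supseteq A$ there is $T\ge 0$ with $\varphi^t(p)\in U$ for all $t\ge T$; then $A\subseteq\mathcal{D}(A)$. The following are equivalent: (a) $A$ is a strong deformation retract of $\mathcal{D}(A)$, i.e. there is a retraction $r:\mathcal{D}(A)\to A$ such that $r$, followed by the inclusion $A\hookrightarrow\mathcal{D}(A)$, is homotopic to $\mathrm{id}_{\mathcal{D}(A)}$ relative to $A$; (b) the inclusion $\iota_A:A\hookrightarrow\mathcal{D}(A)$ is a (Hurewicz) cofibration, i.e. for every topological space $Y$, every continuous $g:\mathcal{D}(A)\to Y$ and every homotopy $H:A\times[0,1]\to Y$ with $H(\cdot,0)=g|_A$ there is a homotopy $G:\mathcal{D}(A)\times[0,1]\to Y$ with $G(\cdot,0)=g$ and $G|_{A\times[0,1]}=H$. -/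

import Mathlib

open scoped NNReal unitInterval

namespace SemiDyn

section Dynamics

variable {M : Type*} [TopologicalSpace M]

/-- A start point of a global semiflow: a point that is not of the form `φ t y` with `t > 0`. -/
def IsStartPoint (φ : Flow ℝ≥0 M) (x : M) : Prop :=
  ∀ t : ℝ≥0, 0 < t → ∀ y : M, φ t y ≠ x

/-- The set `φ(t, S)` for a real time `t`: the image of `S` under the time-`t` map if `0 ≤ t`, and
its preimage under the time-`|t|` map if `t < 0`. -/
noncomputable def timeTranslate (φ : Flow ℝ≥0 M) (t : ℝ) (S : Set M) : Set M :=
  if 0 ≤ t then φ t.toNNReal '' S else φ (-t).toNNReal ⁻¹' S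

/-- Invariance, `φ(ℝ, S) = S`. -/
def IsInvariantSet (φ : Flow ℝ≥0 M) (S : Set M) : Prop :=
  ⋃ t : ℝ, timeTranslate φ t S = S

/-- A compact, invariant, (locally) asymptotically stable attractor. -/
structure IsAttractor (φ : Flow ℝ≥0 M) (A : Set M) : Prop where
  isCompact : IsCompact A
  invariant : IsInvariantSet φ A
  stable : ∀ U : Set M, IsOpen U → A ⊆ U →
    ∃ V : Set M, IsOpen V ∧ A ⊆ V ∧ V ⊆ U ∧ ∀ t : ℝ≥0, ∀ x ∈ V, φ t x ∈ U
  attractive : ∃ W : Set M, IsOpen W ∧ A ⊆ W ∧ ∀ p ∈ W, ∀ V : Set M, IsOpen V → A ⊆ V →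
    ∃ T : ℝ≥0, ∀ t : ℝ≥0, T ≤ t → φ t p ∈ V

/-- The domain of attraction of `A`. -/
def domainOfAttraction (φ : Flow ℝ≥0 M) (A : Set M) : Set M :=
  {p | ∀ U : Set M, IsOpen U → A ⊆ U → ∃ T : ℝ≥0, ∀ t : ℝ≥0, T ≤ t → φ t p ∈ U}

/-- Invariance says that an orbit point lies in `S` exactly when its initial point does. -/
theorem isInvariantSet_iff (φ : Flow ℝ≥0 M) (S : Set M) :
    IsInvariantSet φ S ↔ ∀ (t : ℝ≥0) (x : M), φ t x ∈ S ↔ x ∈ S := by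
  constructor
  · intro h t x
    have key : ∀ s : ℝ, timeTranslate φ s S ⊆ S := fun s =>
      (Set.subset_iUnion (fun s : ℝ => timeTranslate φ s S) s).trans h.subset
    constructor
    · intro hx
      rcases eq_or_lt_of_le (zero_le (a := t)) with rfl | ht
      · simpa using hx
      · apply key (-(t : ℝ))
        have : ¬ (0 : ℝ) ≤ -(t : ℝ) := by
          have : (0 : ℝ) < t := ht
          linarith
        simpa [timeTranslate, this] using hx
    · intro hx
      apply key (t : ℝ)
      have : (0 : ℝ) ≤ (t : ℝ) := t.2
      simp only [timeTranslate, this, if_true, Real.toNNReal_coe]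
      exact ⟨x, hx, rfl⟩
  · intro h
    apply Set.Subset.antisymm
    · apply Set.iUnion_subset
      intro t x hx
      unfold timeTranslate at hx
      split_ifs at hx
      · obtain ⟨y, hy, rfl⟩ := hx
        exact (h _ _).2 hy
      · exact (h _ _).1 hx
    · intro x hx
      refine Set.mem_iUnion.2 ⟨0, ?_⟩
      simpa [timeTranslate] using hx

theorem IsAttractor.subset_domainOfAttraction {φ : Flow ℝ≥0 M} {A : Set M}
    (hA : IsAttractor φ A) : A ⊆ domainOfAttraction φ A := fun x hx _ _ hAU =>
  ⟨0, fun t _ => hAU (((isInvariantSet_iff φ A).1 hA.invariant t x).2 hx)⟩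

end Dynamics

/-- `A` is a strong deformation retract of `X`: there is a retraction `r : X → A` such that the
identity of `X` is homotopic, relative to `A`, to `r` followed by the inclusion of `A`. -/
def IsStrongDeformationRetract {X : Type*} [TopologicalSpace X] (A : Set X) : Prop :=
  ∃ r : C(X, A), (∀ a : A, r a = a) ∧
    (ContinuousMap.id X).HomotopicRel
      ((ContinuousMap.mk (Subtype.val : A → X) continuous_subtype_val).comp r) A

/-- A (Hurewicz) cofibration: a continuous map with the homotopy extension property with respect to
every space `Y`. -/
def IsHurewiczCofibration.{u} {A X : Type u} [TopologicalSpace A] [TopologicalSpace X]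
    (i : C(A, X)) : Prop :=
  ∀ (Y : Type u) [TopologicalSpace Y] (g : C(X, Y)) (H : C(A × I, Y)),
    (∀ a : A, H (a, 0) = g (i a)) →
      ∃ G : C(X × I, Y), (∀ x : X, G (x, 0) = g x) ∧ ∀ (a : A) (s : I), G (i a, s) = H (a, s)

end SemiDyn

/-! From (b) to (a): the cofibration deforms a neighbourhood of `A` into `A`, and the flow carries
each point of the domain into that neighbourhood after a time depending continuously on the point
(`IsAttractor.exists_continuous_time`). Flowing and deforming together pushes the whole domain into
`A`, keeping `A` in itself but not pointwise fixed; the cofibration data repair this. From (a) to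
(b): a strong deformation retract that is a zero set is a cofibration. A compact `Gδ` is a zero set,
and `IsAttractor.isGδ` holds because, without start points, a point near `A` but outside it has a
backward orbit leaving a compact neighbourhood in finite time. -/

namespace SemiDyn

open Set Filter Topology

section Cofibration

universe u

variable {B X : Type u} [TopologicalSpace B] [TopologicalSpace X]

/-- The data of a deformation of a neighbourhood of the range of a cofibration into that range. -/
theorem IsHurewiczCofibration.exists_deformation {i : C(B, X)} (hi : IsHurewiczCofibration i) :
    ∃ (h : C(X × I, X)) (w : C(X, I)), (∀ x, h (x, 0) = x) ∧ (∀ b t, h (i b, t) = i b) ∧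
      (∀ b, w (i b) = 1) ∧ ∀ x, w x ≠ 0 → h (x, 1) ∈ range i := by
  -- Extension into `X × 0 ∪ range i × I` retracts the cylinder onto it; `h` and `w` are the
  -- components of this retraction.
  obtain ⟨G, hG0, hG⟩ := hi {p : X × I // p.2 = 0 ∨ p.1 ∈ range i}
    ⟨fun x => ⟨(x, 0), Or.inl rfl⟩, by fun_prop⟩
    ⟨fun p => ⟨(i p.1, p.2), Or.inr ⟨p.1, rfl⟩⟩, by fun_prop⟩ (fun _ => rfl)
  refine ⟨⟨fun p => (G p).1.1, by fun_prop⟩, ⟨fun x => (G (x, 1)).1.2, by fun_prop⟩,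
    fun x => by simp [hG0], fun b t => by simp [hG], fun b => by simp [hG], fun x hx => ?_⟩
  exact (G (x, 1)).2.resolve_left hx

/-- If the identity deforms into the range of a cofibration through maps preserving this range, then
the range is a strong deformation retract. -/
theorem IsHurewiczCofibration.isStrongDeformationRetract {i : C(B, X)} {h : C(X × I, X)}
    {w : C(X, I)} (h0 : ∀ x, h (x, 0) = x) (hi : ∀ b t, h (i b, t) = i b)
    (wi : ∀ b, w (i b) = 1) (hw : ∀ x, w x ≠ 0 → h (x, 1) ∈ range i)
    (K : C(X × I, X)) (K0 : ∀ x, K (x, 0) = x) (K1 : ∀ x, K (x, 1) ∈ range i)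
    (Ki : ∀ b t, K (i b, t) ∈ range i) : IsStrongDeformationRetract (range i) := by
  -- `K` runs for time `1 - w x`: not at all on the range, and fully where `h` may miss it.
  have key : ∀ x, K (h (x, 1), unitInterval.symm (w x)) ∈ range i := by
    intro x
    by_cases hx : w x = 0
    · simpa [hx] using K1 _
    · obtain ⟨b, hb⟩ := hw x hx
      rw [← hb]
      exact Ki _ _
  refine ⟨⟨fun x => ⟨K (h (x, 1), unitInterval.symm (w x)), key x⟩, by fun_prop⟩, ?_, ⟨?_⟩⟩
  · rintro ⟨_, b, rfl⟩
    ext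
    simp [hi, wi, K0]
  · exact
      { toFun := fun p => K (h (p.2, p.1), p.1 * unitInterval.symm (w p.2))
        continuous_toFun := by fun_prop
        map_zero_left := fun x => by simp [h0, K0]
        map_one_left := fun x => by simp
        prop' := by
          rintro t _ ⟨b, rfl⟩
          simp [hi, wi, K0] }

/-- Reparametrizing a homotopy relative to the zero set of `v` by `t / v x` keeps it continuous. -/
theorem continuous_homotopy_div {h : C(X × I, X)} {v : C(X, ℝ)}
    (hv : ∀ x, v x = 0 → ∀ t, h (x, t) = x) :
    Continuous fun p : X × I => h (p.1, projIcc (0 : ℝ) 1 zero_le_one ((p.2 : ℝ) / v p.1)) := by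
  rw [continuous_iff_continuousAt]
  rintro ⟨x, t⟩
  by_cases hx : v x = 0
  · unfold ContinuousAt
    simp only [hv x hx]
    rw [tendsto_nhds]
    intro O hO hxO
    -- Uniformity in `s`, by compactness of `I`, makes the wild quotient near zeros of `v` harmless.
    have : ∀ᶠ y in 𝓝 x, ∀ s ∈ (univ : Set I), h (y, s) ∈ O := by
      refine isCompact_univ.eventually_forall_of_forall_eventually fun s _ => ?_
      have : O ∈ 𝓝 (h (x, s)) := by rw [hv x hx]; exact hO.mem_nhds hxO
      exact h.continuous.continuousAt.eventually this
    have h2 := (continuous_fst (X := X) (Y := I)).continuousAt (x := (x, t)) |>.eventually this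
    filter_upwards [h2] with p hp using hp _ (mem_univ _)
  · have h1 : ContinuousAt (fun p : X × I => (p.2 : ℝ) / v p.1) (x, t) :=
      ContinuousAt.div (by fun_prop) (by fun_prop) hx
    have h2 : ContinuousAt
        (fun p : X × I => projIcc (0 : ℝ) 1 zero_le_one ((p.2 : ℝ) / v p.1)) (x, t) :=
      ContinuousAt.comp (g := projIcc (0 : ℝ) 1 zero_le_one)
        continuous_projIcc.continuousAt h1
    exact h.continuous.continuousAt.comp (continuousAt_fst.prodMk h2)

/-- An embedding onto a strong deformation retract which is a zero set is a cofibration. -/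
theorem IsStrongDeformationRetract.isHurewiczCofibration {i : C(B, X)} (hi : IsEmbedding i)
    (hs : IsStrongDeformationRetract (range i)) (v : C(X, ℝ)) (v0 : ∀ x, 0 ≤ v x)
    (hv : ∀ x, v x = 0 ↔ x ∈ range i) : IsHurewiczCofibration i := by
  intro Y _ g H hH
  obtain ⟨r, hr, ⟨F⟩⟩ := hs
  let h : C(X × I, X) := ⟨fun p => F (p.2, p.1), by fun_prop⟩
  have hrel : ∀ x, v x = 0 → ∀ t, h (x, t) = x := fun x hx t => F.eq_fst t ((hv x).1 hx)
  have h0 : ∀ x, h (x, 0) = x := fun x => F.map_zero_left x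
  have h1 : ∀ x, h (x, 1) = r x := fun x => F.map_one_left x
  let q : X → B := fun x => hi.toHomeomorph.symm (r x)
  have hq : Continuous q := by fun_prop
  have hiq : ∀ x, i (q x) = r x := fun x =>
    congrArg Subtype.val (hi.toHomeomorph.apply_symm_apply (r x))
  have hqi : ∀ b, q (i b) = b := fun b => by
    apply hi.injective
    rw [hiq, hr ⟨i b, b, rfl⟩]
  classical
  -- Up to time `v x` the point is retracted at speed `1 / v x`; from then on its image follows `H`.
  refine ⟨⟨fun p => if (p.2 : ℝ) ≤ v p.1
      then g (h (p.1, projIcc (0 : ℝ) 1 zero_le_one ((p.2 : ℝ) / v p.1)))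
      else H (q p.1, projIcc (0 : ℝ) 1 zero_le_one ((p.2 : ℝ) - v p.1)), ?_⟩, ?_, ?_⟩
  · refine Continuous.if_le (g.continuous.comp (continuous_homotopy_div hrel)) ?_ (by fun_prop)
      (by fun_prop) ?_
    · refine H.continuous.comp ((hq.comp continuous_fst).prodMk (continuous_projIcc.comp ?_))
      fun_prop
    · rintro ⟨x, t⟩ (hxt : (t : ℝ) = v x)
      have e0 : projIcc (0 : ℝ) 1 zero_le_one 0 = 0 := projIcc_left _
      have e1 : projIcc (0 : ℝ) 1 zero_le_one 1 = 1 := projIcc_right _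
      simp only [hxt, sub_self, e0, hH, hiq]
      by_cases hx : v x = 0
      · rw [hrel x hx, ← h1, hrel x hx]
      · rw [div_self hx, e1, h1]
  · intro x
    simp [v0, h0]
  · intro b s
    have hb : v (i b) = 0 := (hv _).2 ⟨b, rfl⟩
    simp only [ContinuousMap.coe_mk, hb, sub_zero, projIcc_val, hqi, hrel _ hb]
    split_ifs with hs
    · have : s = 0 := Subtype.ext (le_antisymm hs s.2.1)
      rw [this, hH]
    · rfl

end Cofibration

section Dynamics

variable {M : Type*} [TopologicalSpace M] {φ : Flow ℝ≥0 M} {A : Set M}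

theorem IsAttractor.map_mem_iff (hA : IsAttractor φ A) (t : ℝ≥0) (x : M) : φ t x ∈ A ↔ x ∈ A :=
  (isInvariantSet_iff φ A).1 hA.invariant t x

theorem continuous_flow (φ : Flow ℝ≥0 M) : Continuous fun p : ℝ≥0 × M => φ p.1 p.2 :=
  φ.cont'

theorem map_mem_domainOfAttraction {x : M} (hx : x ∈ domainOfAttraction φ A) (t : ℝ≥0) :
    φ t x ∈ domainOfAttraction φ A := by
  intro U hU hAU
  obtain ⟨T, hT⟩ := hx U hU hAU
  refine ⟨T, fun s hs => ?_⟩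
  rw [← φ.map_add]
  exact hT _ (hs.trans le_self_add)

theorem map_mem_of_le {V U : Set M} (hVU : ∀ t : ℝ≥0, ∀ x ∈ V, φ t x ∈ U) {s t : ℝ≥0} {x : M}
    (hx : φ s x ∈ V) (hst : s ≤ t) : φ t x ∈ U := by
  rw [← tsub_add_cancel_of_le hst, φ.map_add]
  exact hVU _ _ hx

/-- A continuous choice of times at which the points of the domain of attraction have entered a
given neighbourhood of the attractor. -/
theorem IsAttractor.exists_continuous_time [T2Space M] [LocallyCompactSpace M]
    (hA : IsAttractor φ A) {N : Set M} (hN : IsOpen N) (hAN : A ⊆ N) :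
    ∃ τ : C(domainOfAttraction φ A, ℝ≥0), ∀ x, φ (τ x) x ∈ N := by
  obtain ⟨V, hV, hAV, -, hVN⟩ := hA.stable N hN hAN
  obtain ⟨K, hK, hAK, hKV⟩ := exists_compact_between hA.isCompact hV hAV
  obtain ⟨V', hV', hAV', -, hVK⟩ := hA.stable (interior K) isOpen_interior hAK
  obtain ⟨f, hf0, hf1, hf⟩ := exists_continuous_zero_one_of_isCompact hK hV.isClosed_compl
    (disjoint_compl_right_iff_subset.2 hKV)
  -- The weight is 1 outside `V` and 0 once the orbit stays in `K`, so the supremum over `s` is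
  -- finite, locally taken over a fixed compact interval, and at least every time spent outside `V`.
  let g : domainOfAttraction φ A → ℝ≥0 → ℝ≥0 := fun x s => s * (f (φ s x)).toNNReal
  have hg : Continuous ↿g := by
    refine continuous_snd.mul (continuous_real_toNNReal.comp (f.continuous.comp ?_))
    exact (continuous_flow φ).comp
      (continuous_snd.prodMk (continuous_subtype_val.comp continuous_fst))
  have hgle : ∀ x s, g x s ≤ s := fun x s => by
    have : (f (φ s x)).toNNReal ≤ 1 := Real.toNNReal_le_one.2 (hf _).2
    calc g x s ≤ s * 1 := mul_le_mul_right this s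
      _ = s := mul_one s
  have hgz : ∀ (x : domainOfAttraction φ A) s T, φ T (x : M) ∈ V' → T ≤ s → g x s = 0 := fun x s T hx hT => by
    have : f (φ s x) = 0 := hf0 (interior_subset (map_mem_of_le hVK hx hT))
    simp [g, this]
  have hgT : ∀ (x : domainOfAttraction φ A) s T, φ T (x : M) ∈ V' → g x s ≤ T := fun x s T hx => by
    rcases le_total T s with h | h
    · rw [hgz x s T hx h]; exact zero_le
    · exact (hgle x s).trans h
  have hT : ∀ x : domainOfAttraction φ A, ∃ T, φ T (x : M) ∈ V' := fun x =>
    (x.2 V' hV' hAV').imp fun T h => h T le_rfl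
  have hbdd : ∀ x, BddAbove (range (g x)) := fun x => by
    obtain ⟨T, hx⟩ := hT x
    exact ⟨T, by rintro _ ⟨s, rfl⟩; exact hgT x s T hx⟩
  have hτ : Continuous fun x => ⨆ s, g x s := by
    rw [continuous_iff_continuousAt]
    intro x
    obtain ⟨T, hx⟩ := hT x
    have hc : Continuous fun x => sSup (g x '' Icc 0 T) := isCompact_Icc.continuous_sSup hg
    refine hc.continuousAt.congr ?_
    have hopen : IsOpen {y : domainOfAttraction φ A | φ T (y : M) ∈ V'} :=
      hV'.preimage (((φ.continuous_toFun T)).comp continuous_subtype_val)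
    filter_upwards [hopen.mem_nhds hx] with y hy
    apply le_antisymm
    · exact csSup_le_csSup (hbdd y) ⟨_, mem_image_of_mem _ ⟨le_rfl, zero_le⟩⟩
        (image_subset_range _ _)
    · refine ciSup_le fun s => ?_
      rcases le_total T s with h | h
      · rw [hgz y s T hy h]; exact zero_le
      · exact le_csSup ((hbdd y).mono (image_subset_range _ _))
          (mem_image_of_mem _ ⟨zero_le, h⟩)
  refine ⟨⟨fun x => (⨆ s, g x s) + 1, hτ.add continuous_const⟩, fun x => ?_⟩
  by_contra hx
  have hnV : φ ((⨆ s, g x s) + 1) (x : M) ∉ V := fun h => hx (map_mem_of_le hVN h le_rfl)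
  have h1 : g x ((⨆ s, g x s) + 1) = (⨆ s, g x s) + 1 := by
    have : f (φ ((⨆ s, g x s) + 1) x) = 1 := hf1 hnV
    simp only [g] at this ⊢
    rw [this]
    simp
  have h2 := le_ciSup (hbdd x) ((⨆ s, g x s) + 1)
  rw [h1] at h2
  exact absurd h2 (not_le.2 (lt_add_one _))

/-- An attractor attracts compact subsets of its domain of attraction uniformly. -/
theorem IsAttractor.exists_forall_map_mem (hA : IsAttractor φ A) {K : Set M} (hK : IsCompact K)
    (hKD : K ⊆ domainOfAttraction φ A) {U : Set M} (hU : IsOpen U) (hAU : A ⊆ U) :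
    ∃ T : ℝ≥0, ∀ t, T ≤ t → ∀ x ∈ K, φ t x ∈ U := by
  obtain ⟨V, hV, hAV, -, hVU⟩ := hA.stable U hU hAU
  refine hK.induction_on (p := fun S => ∃ T : ℝ≥0, ∀ t, T ≤ t → ∀ x ∈ S, φ t x ∈ U)
    ⟨0, by simp⟩ ?_ ?_ ?_
  · rintro s t hst ⟨T, hT⟩
    exact ⟨T, fun a ha x hx => hT a ha x (hst hx)⟩
  · rintro s t ⟨T, hT⟩ ⟨T', hT'⟩
    refine ⟨max T T', fun a ha x hx => hx.elim (hT a ((le_max_left _ _).trans ha) x)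
      (hT' a ((le_max_right _ _).trans ha) x)⟩
  · intro x hx
    obtain ⟨T, hT⟩ := hKD hx V hV hAV
    refine ⟨φ T ⁻¹' V, mem_nhdsWithin_of_mem_nhds
      ((hV.preimage (φ.continuous_toFun T)).mem_nhds (hT T le_rfl)),
      T, fun t ht y hy => map_mem_of_le hVU hy ht⟩

/-- In a semiflow without start points, a point whose backward orbits do not meet the boundary of a
compact neighbourhood has backward orbits of any length inside that neighbourhood. -/
theorem exists_backward_orbit [T2Space M] (hstart : ∀ x, ¬ IsStartPoint φ x) {K : Set M}
    (hK : IsCompact K) {x : M} (hxK : x ∈ K)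
    (hx : ∀ t, ∀ y ∈ K \ interior K, φ t y ≠ x) (T : ℝ≥0) : ∃ y ∈ K, φ T y = x := by
  let E : Set (ℝ≥0 × M) := {p | φ p.1 p.2 = x}
  have hE : IsClosed E := isClosed_eq (continuous_flow φ) continuous_const
  have hC : IsCompact (Prod.fst '' ((Icc 0 T ×ˢ K) ∩ E)) :=
    ((isCompact_Icc.prod hK).inter_right hE).image continuous_fst
  -- Take the longest backward time up to `T` with an endpoint in `K`; if it were below `T`, the
  -- endpoint, interior and not a start point, could be moved further back.
  obtain ⟨t, ⟨⟨t, y⟩, ⟨⟨ht, hy⟩, hty⟩, rfl⟩, hmax⟩ :=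
    hC.exists_isGreatest ⟨0, (0, x), ⟨⟨⟨le_rfl, zero_le⟩, hxK⟩, φ.map_zero_apply x⟩, rfl⟩
  simp only at ht hy hty hmax
  rcases ht.2.eq_or_lt with rfl | htT
  · exact ⟨y, hy, hty⟩
  exfalso
  have hyi : y ∈ interior K := by
    by_contra h
    exact hx t y ⟨hy, h⟩ hty
  obtain ⟨ε, hε, z, hz⟩ : ∃ ε : ℝ≥0, 0 < ε ∧ ∃ z, φ ε z = y := by
    have := hstart y
    unfold IsStartPoint at this
    push Not at this
    exact this
  have hcont : Continuous fun δ : ℝ≥0 => φ (ε - δ) z :=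
    (continuous_flow φ).comp ((continuous_const.sub continuous_id).prodMk continuous_const)
  have hev : ∀ᶠ δ in 𝓝 (0 : ℝ≥0), φ (ε - δ) z ∈ interior K := by
    refine hcont.continuousAt.eventually (isOpen_interior.mem_nhds ?_)
    simpa [hz] using hyi
  have hev' : ∀ᶠ δ in 𝓝[>] (0 : ℝ≥0), φ (ε - δ) z ∈ interior K ∧ δ < ε ∧ δ < T - t ∧ 0 < δ := by
    filter_upwards [nhdsWithin_le_nhds hev, nhdsWithin_le_nhds (Iio_mem_nhds hε),
      nhdsWithin_le_nhds (Iio_mem_nhds (tsub_pos_of_lt htT)), self_mem_nhdsWithin]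
      with δ h1 h2 h3 h4 using ⟨h1, h2, h3, h4⟩
  obtain ⟨δ, h1, h2, h3, h4⟩ := hev'.exists
  have hle : t + δ ≤ t := by
    refine hmax ⟨(t + δ, φ (ε - δ) z), ⟨⟨⟨zero_le, ?_⟩, interior_subset h1⟩, ?_⟩, rfl⟩
    · exact (lt_tsub_iff_left.1 h3).le
    · change φ (t + δ) (φ (ε - δ) z) = x
      rw [← φ.map_add, add_assoc, add_tsub_cancel_of_le h2.le, φ.map_add, hz]
      exact hty
  exact absurd hle (not_le.2 (lt_add_of_pos_right t h4))

/-- In a semiflow without start points, attractors are `Gδ` sets. -/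
theorem IsAttractor.isGδ [T2Space M] [LocallyCompactSpace M] (hA : IsAttractor φ A)
    (hstart : ∀ x, ¬ IsStartPoint φ x) : IsGδ A := by
  obtain ⟨W, hW, hAW, hWD⟩ := hA.attractive
  obtain ⟨K, hK, hAK, hKW⟩ := exists_compact_between hA.isCompact hW hAW
  have hKD : K ⊆ domainOfAttraction φ A := fun x hx => hWD x (hKW hx)
  let C : ℕ → Set M := fun n =>
    (fun p : ℝ≥0 × M => φ p.1 p.2) '' (Icc 0 (n : ℝ≥0) ×ˢ (K \ interior K))
  have hC : ∀ n, IsClosed (C n) := fun n =>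
    ((isCompact_Icc.prod (hK.diff isOpen_interior)).image (continuous_flow φ)).isClosed
  -- `C n` consists of the points reached from `K \ interior K` within time `n`.
  have hAeq : A = interior K ∩ ⋂ n, (C n)ᶜ := by
    apply Subset.antisymm
    · refine fun x hx => ⟨hAK hx, mem_iInter.2 fun n => ?_⟩
      rintro ⟨⟨t, y⟩, ⟨-, -, hy⟩, rfl⟩
      exact hy (hAK ((hA.map_mem_iff t y).1 hx))
    · rintro x ⟨hxK, hxC⟩
      by_contra hxA
      -- Uniform attraction keeps `K` off `x` from time `T` on, yet a backward orbit of length `T`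
      -- starts in `K` and ends at `x`.
      obtain ⟨T, hT⟩ := hA.exists_forall_map_mem hK hKD (U := {x}ᶜ) isOpen_compl_singleton
        (fun a ha hax => hxA (mem_singleton_iff.1 hax ▸ ha))
      obtain ⟨y, hyK, hy⟩ := exists_backward_orbit hstart hK (interior_subset hxK)
        (fun t y hy hty => by
          obtain ⟨n, hn⟩ := exists_nat_ge t
          exact mem_iInter.1 hxC n ⟨(t, y), ⟨⟨zero_le, hn⟩, hy⟩, hty⟩) T
      exact hT T le_rfl y hyK hy
  rw [hAeq]
  exact isOpen_interior.isGδ.inter (IsGδ.iInter fun n => (hC n).isOpen_compl.isGδ)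

end Dynamics

end SemiDyn

theorem theorem3 {M : Type*} [TopologicalSpace M] [T2Space M] [LocallyCompactSpace M]
    (φ : Flow ℝ≥0 M) (hstart : {x : M | SemiDyn.IsStartPoint φ x} = ∅)
    (A : Set M) (hA : SemiDyn.IsAttractor φ A) :
    SemiDyn.IsStrongDeformationRetract
        (Subtype.val ⁻¹' A : Set (SemiDyn.domainOfAttraction φ A)) ↔
      SemiDyn.IsHurewiczCofibration
        (ContinuousMap.inclusion hA.subset_domainOfAttraction) := by
  open Set SemiDyn in
  have hrange : (Subtype.val ⁻¹' A : Set (domainOfAttraction φ A)) =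
      range (ContinuousMap.inclusion hA.subset_domainOfAttraction) :=
    (range_inclusion hA.subset_domainOfAttraction).symm
  have hmem : ∀ x, x ∈ range (ContinuousMap.inclusion hA.subset_domainOfAttraction) ↔
      (x : M) ∈ A := fun x => by rw [← hrange]; rfl
  rw [hrange]
  constructor
  · intro hs
    obtain ⟨f, hf1, -, -, hf⟩ := exists_continuous_one_zero_of_isCompact_of_isGδ hA.isCompact
      (hA.isGδ (eq_empty_iff_forall_notMem.1 hstart)) isClosed_empty (disjoint_empty A)
    refine hs.isHurewiczCofibration
      (Topology.IsEmbedding.inclusion hA.subset_domainOfAttraction)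
      ⟨fun x => 1 - f x, by fun_prop⟩ (fun x => sub_nonneg.2 (hf x).2) fun x => ?_
    rw [hmem, show (x : M) ∈ A ↔ f x = 1 from Set.ext_iff.1 hf1 x]
    exact sub_eq_zero.trans eq_comm
  · intro hc
    obtain ⟨h, w, h0, hi, wi, hw⟩ := hc.exists_deformation
    obtain ⟨N, hN, hNw⟩ := isOpen_induced_iff.1
      ((isOpen_compl_singleton (x := (0 : I))).preimage w.continuous)
    have hNw' : ∀ x : domainOfAttraction φ A, (x : M) ∈ N ↔ w x ≠ 0 := fun x =>
      Set.ext_iff.1 hNw x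
    obtain ⟨τ, hτ⟩ := hA.exists_continuous_time hN fun a ha =>
      (hNw' ⟨a, hA.subset_domainOfAttraction ha⟩).2 (by
        have := wi ⟨a, ha⟩
        exact this ▸ one_ne_zero)
    let ψ : C(domainOfAttraction φ A × I, domainOfAttraction φ A) :=
      ⟨fun p => ⟨φ (unitInterval.toNNReal p.2 * τ p.1) p.1,
        map_mem_domainOfAttraction p.1.2 _⟩, by
        have : Continuous fun p : domainOfAttraction φ A × I =>
            (unitInterval.toNNReal p.2 * τ p.1, (p.1 : M)) := by fun_prop
        exact ((continuous_flow φ).comp this).subtype_mk _⟩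
    -- At time 1 the flow has reached `N`, where `w ≠ 0`, so `h` ends in `A`.
    refine IsHurewiczCofibration.isStrongDeformationRetract h0 hi wi hw
      ⟨fun p => h (ψ p, p.2), by fun_prop⟩ (fun x => ?_) (fun x => hw _ ?_) fun b t => ?_
    · have : ψ (x, 0) = x := Subtype.ext (by simp [ψ])
      simp [h0, this]
    · refine (hNw' _).1 ?_
      simpa [ψ] using hτ x
    · obtain ⟨b', hb'⟩ := (hmem (ψ (ContinuousMap.inclusion _ b, t))).2
        ((hA.map_mem_iff _ _).2 b.2)
      change h (ψ (_, t), t) ∈ _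
      rw [← hb', hi]
      exact ⟨b', rfl⟩
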